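/- Let $G$ be a finite simple undirected graph with $n \ge 3$ vertices and $e$ edges, with minimum degree $\delta$ and maximum degree $\Delta$, and let $M_1(G) = \sum_{u \in V(G)} d_G(u)^2$ be its first Zagreb index. Let $k \ge 2$ be an integer and suppose that $G$ is $k$-connected, that is, $n > k$ and deleting any set of fewer than $k$ vertices leaves a connected graph. If $$M_1(G) \ge (n-k-1)\Delta^2 + \frac{\bigl(e(\delta+n-k-1)\bigr)^2}{4\delta(n-k-1)(k+1)},$$ then $G$ has a Hamiltonian cycle or $G$ is isomorphic to the complete bipartite graph $K_{k,k+1}$. (In the degenerate case $n = k+1$, where $G$ is complete, the fraction is read as $0$.) -/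

import Mathlib

/-- `G` is `k`-connected (in the sense of vertex connectivity): it has more than `k` vertices, and
deleting any set of fewer than `k` vertices leaves a connected graph. -/
def SimpleGraph.IsKConnected {V : Type*} [Fintype V] (G : SimpleGraph V) (k : ℕ) : Prop :=
  k < Fintype.card V ∧
    ∀ S : Finset V, S.card < k → (G.induce ((S : Set V)ᶜ)).Connected

/-- The first Zagreb index of `G`: the sum of the squares of the degrees of its vertices. -/
def SimpleGraph.firstZagrebIndex {V : Type*} [Fintype V] (G : SimpleGraph V)
    [DecidableRel G.Adj] : ℕ :=
  ∑ u : V, G.degree u ^ 2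

/-! Let `G` be non-Hamiltonian. A longest cycle misses some vertex `v`; by `k`-connectedness the
component of `v` off the cycle is attached to it at `k` or more vertices, and `v` together with the
successors of these along the cycle is independent, since any edge among them would give a longer
cycle (Chvátal–Erdős). So there is an independent set `S` with `k + 1` elements.

The degrees of the vertices in `S` lie between `δ` and `#Sᶜ = n - k - 1` and add up to at most `e`,
so the Pólya–Szegő inequality bounds the sum of their squares by the fraction in the hypothesis; the
other vertices contribute at most `(n - k - 1) Δ²`. Hence all these bounds are attained: every edge
meets `S`, the vertices outside `S` have degree `Δ`, and from the two degree sums over `S` every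
vertex of `S` has degree `#Sᶜ ≤ #S`. Thus `G` is complete bipartite with parts `S` and `Sᶜ`, and as
`k ≤ δ ≤ #Sᶜ ≤ k + 1` it is `K_{k,k+1}` or the Hamiltonian graph `K_{k+1,k+1}`. -/

section LongestCycle

open SimpleGraph Walk

variable {V : Type*} {G : SimpleGraph V} {s : Set V} {u v x y : V} {d d' : G.Dart}

theorem support_append_cons (p : G.Walk u v) (h : G.Adj v x) (q : G.Walk x y) :
    (p.append (cons h q)).support = p.support ++ q.support := by
  rw [support_append, support_cons, List.tail_cons]

theorem isPath_append_cons_iff {p : G.Walk u v} {q : G.Walk x y} {h : G.Adj v x} :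
    (p.append (cons h q)).IsPath ↔ p.IsPath ∧ q.IsPath ∧ p.support.Disjoint q.support := by
  simp only [isPath_def, support_append_cons, List.nodup_append']

theorem exists_eq_append_cons_of_mem_darts {p : G.Walk u v} (hd : d ∈ p.darts) :
    ∃ (q : G.Walk u d.fst) (r : G.Walk d.snd v), p = q.append (cons d.adj r) := by
  obtain ⟨q, r, rfl⟩ := (isSubwalk_toWalk_adj_iff_mem_darts p).mpr hd
  exact ⟨q, r, (append_assoc _ _ _).symm⟩

theorem exists_isPath_of_mem_darts {c : G.Walk u u} (hc : c.tail.IsPath) (hd : d ∈ c.darts) :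
    ∃ w : G.Walk d.snd d.fst,
      w.IsPath ∧ w.support ⊆ c.support ∧ (d :: w.darts).Perm c.darts := by
  obtain ⟨q, r, rfl⟩ := exists_eq_append_cons_of_mem_darts hd
  have hperm : (d :: (r.append q).darts).Perm (q.append (cons d.adj r)).darts := by
    simp only [darts_append, darts_cons]
    exact (List.perm_append_comm.cons d).trans List.perm_middle.symm
  refine ⟨r.append q, ?_, ?_, hperm⟩
  · have hnil : ¬ (q.append (cons d.adj r)).Nil := by simp
    rw [isPath_def, ← cons_map_snd_darts, ← List.map_cons (f := fun d : G.Dart ↦ d.snd),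
      (hperm.map _).nodup_iff, map_snd_darts, ← support_tail_of_not_nil _ hnil]
    exact hc.support_nodup
  · intro z hz
    simp only [mem_support_append_iff, support_cons, List.mem_cons] at hz ⊢
    tauto

theorem exists_mem_darts_fst_eq {c : G.Walk u u} (hc : ¬ c.Nil) (hx : x ∈ c.support) :
    ∃ d ∈ c.darts, d.fst = x := by
  rw [← map_fst_darts_append, List.mem_append, List.mem_map, List.mem_singleton] at hx
  rcases hx with hx | rfl
  · exact hx
  · exact ⟨c.firstDart hc, c.firstDart_mem_darts hc, rfl⟩

theorem isHamiltonian_of_isPath_tail [Fintype V] [DecidableEq V] {c : G.Walk u u}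
    (hc : c.tail.IsPath) (hn : 3 ≤ Fintype.card V) (hmem : ∀ v, v ∈ c.support) :
    G.IsHamiltonian := by
  have hnil : ¬ c.Nil := by
    intro h
    have : Fintype.card V = 1 :=
      Fintype.card_eq_one_iff.mpr ⟨u, fun v ↦ by simpa [nil_iff_support_eq.mp h] using hmem v⟩
    omega
  have hspan : c.tail.IsHamiltonian := hc.isHamiltonian_of_mem fun v ↦ by
    rcases eq_or_ne v u with rfl | hv
    · exact c.tail.end_mem_support
    · rw [support_tail_of_not_nil _ hnil]
      exact (mem_support_iff c).mp (hmem v) |>.resolve_left hv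
  have hlen := c.length_tail_add_one hnil
  have := hspan.length_eq
  exact fun _ ↦ ⟨u, c, isHamiltonianCycle_isCycle_and_isHamiltonian_tail.mpr
    ⟨isCycle_iff_isPath_tail_and_le_length.mpr ⟨hc, by omega⟩, hspan⟩⟩

/-- `c` is a longest cycle of `G`. Closed walks without repeated vertices are described by
`c.tail.IsPath` instead of `c.IsCycle`, which also admits the trivial walk and the walk back and
forth along an edge; thus a longest one exists in every finite nonempty graph. -/
structure IsLongestCycle (c : G.Walk u u) : Prop where
  isPath_tail : c.tail.IsPath
  length_le : ∀ {v : V} (c' : G.Walk v v), c'.tail.IsPath → c'.length ≤ c.length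

theorem exists_isLongestCycle [Finite V] [Nonempty V] (G : SimpleGraph V) :
    ∃ (u : V) (c : G.Walk u u), IsLongestCycle c := by
  have := Fintype.ofFinite V
  let lengths : Set ℕ := {m | ∃ (u : V) (c : G.Walk u u), c.tail.IsPath ∧ c.length = m}
  have hfin : lengths.Finite := by
    refine (Set.finite_Iic (Fintype.card V)).subset ?_
    rintro _ ⟨u, c, hc, rfl⟩
    have := hc.length_lt
    rw [length_tail] at this
    exact Set.mem_Iic.mpr (by omega)
  have hne : lengths.Nonempty := ⟨0, Classical.arbitrary V, nil, IsPath.nil, rfl⟩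
  obtain ⟨_, ⟨u, c, hc, rfl⟩, hmax⟩ := hfin.exists_maximal hne
  exact ⟨u, c, hc, fun c' hc' ↦ (le_total _ _).elim id fun h ↦ hmax ⟨_, c', hc', rfl⟩ h⟩

/-- The component `K` of the subgraph induced on `s` has a neighbour `x` in `G`. With `s` the
complement of a cycle, this singles out the vertices at which `K` is attached to the cycle. -/
def Touches (K : (G.induce s).ConnectedComponent) (x : V) : Prop :=
  ∃ a ∈ K.supp, G.Adj x a

theorem Touches.exists_isPath {K : (G.induce s).ConnectedComponent} (hx : Touches K x)
    (hy : Touches K y) : ∃ (a b : V) (q : G.Walk a b),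
      q.IsPath ∧ (∀ z ∈ q.support, z ∈ s) ∧ G.Adj x a ∧ G.Adj b y := by
  obtain ⟨a, ha, hxa⟩ := hx
  obtain ⟨b, hb, hyb⟩ := hy
  obtain ⟨q, hq⟩ := (ConnectedComponent.exact (ha.trans hb.symm)).exists_isPath
  refine ⟨a, b, q.map (Embedding.induce s).toHom, hq.map Subtype.val_injective, ?_, hxa, hyb.symm⟩
  intro z hz
  obtain ⟨z, -, rfl⟩ := List.mem_map.mp (support_map _ q ▸ hz)
  exact z.2

theorem compl_subset_of_connected_induce_compl {X : Set V}
    (K : (G.induce s).ConnectedComponent) (hX : (G.induce Xᶜ).Connected) (hsX : Disjoint s X)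
    (hK : ∀ x ∉ s, Touches K x → x ∈ X) : sᶜ ⊆ X := by
  intro y hy
  by_contra hyX
  obtain ⟨a, ha⟩ := K.nonempty_supp
  obtain ⟨w⟩ := hX.preconnected ⟨a, hsX.notMem_of_mem_left a.2⟩ ⟨y, hyX⟩
  obtain ⟨d, -, ⟨b, hb, hbd⟩, hd⟩ := w.exists_boundary_dart {z | ∃ b ∈ K.supp, b = (z : V)}
    ⟨a, ha, rfl⟩ (by rintro ⟨b, -, rfl⟩; exact hy b.2)
  have hadj : G.Adj b d.snd := hbd ▸ d.adj
  by_cases hds : (d.snd : V) ∈ s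
  · exact hd ⟨⟨d.snd, hds⟩, K.mem_supp_of_adj_mem_supp hb hadj, rfl⟩
  · exact d.snd.2 (hK _ hds ⟨b, hb, hadj.symm⟩)

namespace IsLongestCycle

variable {c : G.Walk u u}

theorem length_lt_of_adj (hc : IsLongestCycle c) {p : G.Walk x y} (hp : p.IsPath)
    (h : G.Adj y x) : p.length < c.length :=
  hc.length_le (cons h p) (by simpa using hp)

theorem not_nil_of_adj (hc : IsLongestCycle c) (h : G.Adj x y) : ¬ c.Nil := by
  have := hc.length_lt_of_adj (p := h.toWalk) (by simpa using h.ne) h.symm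
  rw [← length_eq_zero_iff]
  omega

theorem not_adj_snd_of_detour (hc : IsLongestCycle c) (hd : d ∈ c.darts) {q : G.Walk x y}
    (hq : q.IsPath) (hqc : c.support.Disjoint q.support) (hx : G.Adj d.fst x) :
    ¬ G.Adj y d.snd := by
  intro hy
  obtain ⟨w, hw, hwc, hperm⟩ := exists_isPath_of_mem_darts hc.isPath_tail hd
  have hlt := hc.length_lt_of_adj
    (isPath_append_cons_iff (h := hx).mpr
      ⟨hw, hq, List.disjoint_of_subset_left hwc hqc⟩) hy
  have hlen := hperm.length_eq
  simp only [List.length_cons, length_darts] at hlen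
  rw [length_append, length_cons] at hlt
  omega

theorem not_adj_snd_snd_of_detour (hc : IsLongestCycle c) (hd : d ∈ c.darts)
    (hd' : d' ∈ c.darts) {q : G.Walk x y} (hq : q.IsPath)
    (hqc : c.support.Disjoint q.support) (hx : G.Adj d.fst x) (hy : G.Adj y d'.fst) :
    ¬ G.Adj d.snd d'.snd := by
  intro hadj
  obtain ⟨w, hw, hwc, hperm⟩ := exists_isPath_of_mem_darts hc.isPath_tail hd
  have hdw : d' ∈ w.darts :=
    (List.mem_cons.mp (hperm.mem_iff.mpr hd')).resolve_left fun h ↦ hadj.ne (by rw [h])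
  obtain ⟨w₁, w₂, rfl⟩ := exists_eq_append_cons_of_mem_darts hdw
  obtain ⟨hw₁, hw₂, hdisj⟩ := isPath_append_cons_iff.mp hw
  have hrev : (w₁.reverse.append (cons hadj w₂)).IsPath :=
    isPath_append_cons_iff.mpr ⟨hw₁.reverse, hw₂, by simpa using hdisj⟩
  have hrevc : (w₁.reverse.append (cons hadj w₂)).support ⊆ c.support := fun z hz ↦ hwc <| by
    simpa only [support_append_cons, support_reverse, List.mem_append, List.mem_reverse] using hz
  have hlt := hc.length_lt_of_adj (isPath_append_cons_iff (h := hx).mpr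
    ⟨hrev, hq, List.disjoint_of_subset_left hrevc hqc⟩) hy
  have hlen := hperm.length_eq
  simp only [List.length_cons, length_darts, length_append, length_cons, length_reverse]
    at hlen hlt
  omega

theorem not_touches_snd (hc : IsLongestCycle c)
    {K : (G.induce {x | x ∉ c.support}).ConnectedComponent} (hd : d ∈ c.darts)
    (h : Touches K d.fst) : ¬ Touches K d.snd := by
  intro h'
  obtain ⟨a, b, q, hq, hqc, ha, hb⟩ := h.exists_isPath h'
  exact hc.not_adj_snd_of_detour hd hq (fun z hz hzq ↦ hqc z hzq hz) ha hb

theorem not_adj_snd_snd (hc : IsLongestCycle c)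
    {K : (G.induce {x | x ∉ c.support}).ConnectedComponent} (hd : d ∈ c.darts)
    (hd' : d' ∈ c.darts) (h : Touches K d.fst) (h' : Touches K d'.fst) :
    ¬ G.Adj d.snd d'.snd := by
  obtain ⟨a, b, q, hq, hqc, ha, hb⟩ := h.exists_isPath h'
  exact hc.not_adj_snd_snd_of_detour hd hd' hq (fun z hz hzq ↦ hqc z hzq hz) ha hb

end IsLongestCycle

theorem le_degree_of_isKConnected [Fintype V] {k : ℕ} (h : G.IsKConnected k) (v : V)
    [Fintype (G.neighborSet v)] : k ≤ G.degree v := by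
  classical
  by_contra! hlt
  let K := (G.induce {v}).connectedComponentMk ⟨v, rfl⟩
  have hsub : ({v}ᶜ : Set V) ⊆ G.neighborFinset v := by
    refine compl_subset_of_connected_induce_compl K (h.2 (G.neighborFinset v) hlt) (by simp) ?_
    rintro x - ⟨⟨_, rfl⟩, -, hxv⟩
    simpa using hxv.symm
  have hcard := Finset.card_le_card (s := {v}ᶜ) (t := G.neighborFinset v) fun x hx ↦
    Finset.mem_coe.mp (hsub (by simpa using hx))
  rw [Finset.card_compl, Finset.card_singleton, card_neighborFinset_eq_degree] at hcard
  have := h.1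
  omega

open scoped Classical in
/-- The edges of the closed walk `c`, in the direction of travel, that start at a vertex touched
by `K`. Their end vertices are the successors used in the Chvátal–Erdős argument. -/
noncomputable def attachingDarts (c : G.Walk u u) (K : (G.induce s).ConnectedComponent) :
    Finset G.Dart :=
  {d ∈ c.darts.toFinset | Touches K d.fst}

theorem mem_attachingDarts {c : G.Walk u u} {K : (G.induce s).ConnectedComponent} :
    d ∈ attachingDarts c K ↔ d ∈ c.darts ∧ Touches K d.fst := by
  simp [attachingDarts]

theorem IsLongestCycle.le_card_attachingDarts [Fintype V] {k : ℕ} (h : G.IsKConnected k)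
    {c : G.Walk u u} (hc : IsLongestCycle c) (hnil : ¬ c.Nil)
    (K : (G.induce {x | x ∉ c.support}).ConnectedComponent) :
    k ≤ (attachingDarts c K).card := by
  classical
  by_contra! hlt
  let X := (attachingDarts c K).image fun d ↦ d.fst
  have hXc : ∀ x ∈ X, x ∈ c.support := by
    simp only [X, Finset.forall_mem_image, mem_attachingDarts]
    exact fun d hd ↦ c.dart_fst_mem_support_of_mem_darts hd.1
  have hKX : ∀ x ∈ c.support, Touches K x → x ∈ X := fun x hx hxK ↦ by
    obtain ⟨d, hd, rfl⟩ := exists_mem_darts_fst_eq hnil hx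
    exact Finset.mem_image_of_mem _ (mem_attachingDarts.mpr ⟨hd, hxK⟩)
  have hX : {x | x ∉ c.support}ᶜ ⊆ (X : Set V) :=
    compl_subset_of_connected_induce_compl K (h.2 X (Finset.card_image_le.trans_lt hlt))
      (Set.disjoint_left.mpr fun x hx hxX ↦ hx (hXc x hxX)) fun x hx ↦ hKX x (not_not.mp hx)
  have htouch : ∀ x ∈ c.support, Touches K x := fun x hx ↦ by
    obtain ⟨d, hd, rfl⟩ := Finset.mem_image.mp (hX (not_not.mpr hx))
    exact (mem_attachingDarts.mp hd).2
  have hd := c.firstDart_mem_darts hnil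
  exact hc.not_touches_snd hd (htouch _ (c.dart_fst_mem_support_of_mem_darts hd))
    (htouch _ (c.dart_snd_mem_support_of_mem_darts hd))

theorem IsLongestCycle.injOn_snd_darts {c : G.Walk u u} (hc : IsLongestCycle c) :
    Set.InjOn (fun d : G.Dart ↦ d.snd) {d | d ∈ c.darts} := by
  by_cases hnil : c.Nil
  · simp [darts_eq_nil.mpr hnil]
  · refine List.inj_on_of_nodup_map ?_
    rw [map_snd_darts, ← support_tail_of_not_nil _ hnil]
    exact hc.isPath_tail.support_nodup

/-- The independent set of the Chvátal–Erdős theorem: a vertex off a longest cycle and the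
successors of the vertices at which its component is attached. -/
theorem IsLongestCycle.isIndepSet_insert_image_snd {c : G.Walk u u} (hc : IsLongestCycle c)
    (hv : v ∉ c.support) : G.IsIndepSet (insert v ((fun d : G.Dart ↦ d.snd) ''
      attachingDarts c ((G.induce {x | x ∉ c.support}).connectedComponentMk ⟨v, hv⟩))) := by
  refine Set.pairwise_insert.mpr ⟨?_, ?_⟩
  · rintro _ ⟨d, hd, rfl⟩ _ ⟨d', hd', rfl⟩ -
    obtain ⟨hd, hK⟩ := mem_attachingDarts.mp hd
    obtain ⟨hd', hK'⟩ := mem_attachingDarts.mp hd'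
    exact hc.not_adj_snd_snd hd hd' hK hK'
  · rintro _ ⟨d, hd, rfl⟩ -
    obtain ⟨hd, hK⟩ := mem_attachingDarts.mp hd
    have hnot : ¬ G.Adj d.snd v := fun h ↦ hc.not_touches_snd hd hK ⟨⟨v, hv⟩, rfl, h⟩
    exact ⟨fun h ↦ hnot h.symm, hnot⟩

/-- The **Chvátal–Erdős theorem**, in contrapositive form. -/
theorem exists_isNIndepSet_of_not_isHamiltonian [Fintype V] [DecidableEq V] {k : ℕ}
    (h : G.IsKConnected k) (hk : 1 ≤ k) (hn : 3 ≤ Fintype.card V) (hG : ¬ G.IsHamiltonian) :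
    ∃ S : Finset V, G.IsNIndepSet (k + 1) S := by
  classical
  have : Nonempty V := Fintype.card_pos_iff.mp (by omega)
  obtain ⟨u, c, hc⟩ := exists_isLongestCycle G
  obtain ⟨x, hux⟩ := (G.degree_pos_iff_exists_adj u).mp (hk.trans (le_degree_of_isKConnected h u))
  obtain ⟨v, hv⟩ : ∃ v, v ∉ c.support := by
    by_contra! hmem
    exact hG (isHamiltonian_of_isPath_tail hc.isPath_tail hn hmem)
  let K := (G.induce {x | x ∉ c.support}).connectedComponentMk ⟨v, hv⟩
  let I := insert v ((attachingDarts c K).image fun d ↦ d.snd)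
  have hI : G.IsIndepSet (I : Set V) := by
    simpa only [I, Finset.coe_insert, Finset.coe_image] using hc.isIndepSet_insert_image_snd hv
  have hdarts : ∀ d ∈ attachingDarts c K, d ∈ c.darts := fun d hd ↦ (mem_attachingDarts.mp hd).1
  have hcard : k + 1 ≤ I.card := by
    rw [Finset.card_insert_of_notMem, Finset.card_image_of_injOn (hc.injOn_snd_darts.mono hdarts)]
    · exact Nat.succ_le_succ (hc.le_card_attachingDarts h (hc.not_nil_of_adj hux) K)
    · simp only [Finset.mem_image, not_exists, not_and]
      rintro d hd rfl
      exact hv (c.dart_snd_mem_support_of_mem_darts (hdarts d hd))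
  obtain ⟨S, hSI, hS⟩ := Finset.exists_subset_card_eq hcard
  exact ⟨S, hI.mono (Finset.coe_subset.mpr hSI), hS⟩

end LongestCycle

section CompleteBipartite

open SimpleGraph

variable {V : Type*} [Fintype V] [DecidableEq V] {G : SimpleGraph V} {S : Finset V} {a b m : ℕ}

/-- `G` is the complete bipartite graph with parts `S` and its complement. -/
def IsCompleteBipartiteOn (G : SimpleGraph V) (S : Finset V) : Prop :=
  ∀ x y, G.Adj x y ↔ (x ∈ S ↔ y ∉ S)

namespace IsCompleteBipartiteOn

theorem nonempty_iso (h : IsCompleteBipartiteOn G S) (ha : Sᶜ.card = a) (hb : S.card = b) :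
    Nonempty (G ≃g completeBipartiteGraph (Fin a) (Fin b)) := by
  let eSc : {x // x ∉ S} ≃ Fin a :=
    (Equiv.subtypeEquivRight fun _ ↦ Finset.mem_compl.symm).trans (Sᶜ.equivFinOfCardEq ha)
  let eS : {x // x ∈ S} ≃ Fin b := S.equivFinOfCardEq hb
  let f : Fin a ⊕ Fin b ≃ V :=
    (eSc.symm.sumCongr eS.symm).trans ((Equiv.sumComm _ _).trans (Equiv.sumCompl (· ∈ S)))
  have fl : ∀ i, f (Sum.inl i) ∉ S := fun i ↦ (eSc.symm i).2
  have fr : ∀ i, f (Sum.inr i) ∈ S := fun i ↦ (eS.symm i).2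
  refine ⟨Iso.symm ⟨f, ?_⟩⟩
  rintro (i | i) (j | j) <;> simp [h _ _, fl, fr]

theorem isKConnected (h : IsCompleteBipartiteOn G S) (hm : 0 < m) (hS : m ≤ S.card)
    (hSc : m ≤ Sᶜ.card) : G.IsKConnected m := by
  refine ⟨by have := S.card_add_card_compl; omega, fun X hX ↦ ?_⟩
  obtain ⟨x, hx, hxX⟩ := Finset.exists_mem_notMem_of_card_lt_card (hX.trans_le hS)
  obtain ⟨y, hy, hyX⟩ := Finset.exists_mem_notMem_of_card_lt_card (hX.trans_le hSc)
  rw [Finset.mem_compl] at hy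
  let x' : ((X : Set V)ᶜ : Set V) := ⟨x, hxX⟩
  let y' : ((X : Set V)ᶜ : Set V) := ⟨y, hyX⟩
  have hadj (v w : ((X : Set V)ᶜ : Set V)) (hvw : (v : V) ∈ S ↔ (w : V) ∉ S) :
      (G.induce (X : Set V)ᶜ).Reachable v w :=
    Adj.reachable (G := G.induce (X : Set V)ᶜ) ((h v w).mpr hvw)
  refine connected_iff_exists_forall_reachable _ |>.mpr ⟨x', fun w ↦ ?_⟩
  by_cases hw : (w : V) ∈ S
  · exact (hadj x' y' (iff_of_true hx hy)).trans (hadj y' w (iff_of_false hy (not_not.mpr hw)))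
  · exact hadj x' w (iff_of_true hx hw)

theorem isHamiltonian (h : IsCompleteBipartiteOn G S) (hm : 2 ≤ m) (hS : S.card = m)
    (hSc : Sᶜ.card = m) : G.IsHamiltonian := by
  by_contra hG
  have hcard := S.card_add_card_compl
  obtain ⟨I, hI, hIcard⟩ := exists_isNIndepSet_of_not_isHamiltonian
    (h.isKConnected (by omega) hS.ge hSc.ge) (by omega) (by omega) hG
  obtain ⟨x, hxI, hx⟩ := Finset.exists_mem_notMem_of_card_lt_card (s := Sᶜ) (t := I) (by omega)
  obtain ⟨y, hyI, hy⟩ := Finset.exists_mem_notMem_of_card_lt_card (s := S) (t := I) (by omega)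
  have hxy : G.Adj x y := (h x y).mpr (iff_of_true (by simpa using hx) hy)
  exact hI hxI hyI hxy.ne hxy

end IsCompleteBipartiteOn

end CompleteBipartite

section IndepSetDegrees

open SimpleGraph

variable {V : Type*} [Fintype V] {G : SimpleGraph V} [DecidableRel G.Adj] {S : Finset V} {x y : V}

theorem card_biUnion_incidenceFinset [DecidableEq V] (hS : G.IsIndepSet (S : Set V)) :
    (S.biUnion fun x ↦ G.incidenceFinset x).card = ∑ x ∈ S, G.degree x := by
  rw [Finset.card_biUnion]
  · simp only [card_incidenceFinset_eq_degree]
  · intro x hx y hy hxy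
    rw [Function.onFun, ← Finset.disjoint_coe, coe_incidenceFinset, coe_incidenceFinset,
      Set.disjoint_iff_inter_eq_empty]
    exact G.incidenceSet_inter_incidenceSet_of_not_adj (hS hx hy hxy) hxy

theorem sum_degree_le_card_edgeFinset (hS : G.IsIndepSet (S : Set V)) :
    ∑ x ∈ S, G.degree x ≤ G.edgeFinset.card := by
  classical
  rw [← card_biUnion_incidenceFinset hS]
  exact Finset.card_le_card (Finset.biUnion_subset.mpr fun x _ ↦ G.incidenceFinset_subset x)

variable [DecidableEq V]

theorem isIndepSet_compl_of_sum_degree_eq (hS : G.IsIndepSet (S : Set V))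
    (h : ∑ x ∈ S, G.degree x = G.edgeFinset.card) : G.IsIndepSet ((Sᶜ : Finset V) : Set V) := by
  have hcover : (S.biUnion fun x ↦ G.incidenceFinset x) = G.edgeFinset :=
    Finset.eq_of_subset_of_card_le
      (Finset.biUnion_subset.mpr fun x _ ↦ G.incidenceFinset_subset x)
      (by rw [card_biUnion_incidenceFinset hS, h])
  rintro y hy z hz - hyz
  have hmem : s(y, z) ∈ S.biUnion fun x ↦ G.incidenceFinset x :=
    hcover ▸ mem_edgeFinset.mpr hyz
  obtain ⟨x, hx, hxyz⟩ := Finset.mem_biUnion.mp hmem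
  rcases Sym2.mem_iff.mp ((G.mem_incidenceFinset x _).mp hxyz).2 with rfl | rfl
  · exact Finset.mem_compl.mp hy hx
  · exact Finset.mem_compl.mp hz hx

theorem neighborFinset_subset_compl_of_isIndepSet (hS : G.IsIndepSet (S : Set V)) (hx : x ∈ S) :
    G.neighborFinset x ⊆ Sᶜ := fun y hy ↦ by
  rw [mem_neighborFinset] at hy
  exact Finset.mem_compl.mpr fun hyS ↦ hS hx hyS hy.ne hy

theorem degree_le_card_compl_of_isIndepSet (hS : G.IsIndepSet (S : Set V)) (hx : x ∈ S) :
    G.degree x ≤ Sᶜ.card :=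
  Finset.card_le_card (neighborFinset_subset_compl_of_isIndepSet hS hx)

theorem adj_of_degree_eq_card_compl (hS : G.IsIndepSet (S : Set V)) (hx : x ∈ S) (hy : y ∉ S)
    (h : G.degree x = Sᶜ.card) : G.Adj x y := by
  rw [← mem_neighborFinset, Finset.eq_of_subset_of_card_le
    (neighborFinset_subset_compl_of_isIndepSet hS hx) h.ge]
  exact Finset.mem_compl.mpr hy

theorem isCompleteBipartiteOn_of_degree_eq_card_compl (hS : G.IsIndepSet (S : Set V))
    (hSc : G.IsIndepSet ((Sᶜ : Finset V) : Set V)) (h : ∀ x ∈ S, G.degree x = Sᶜ.card) :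
    IsCompleteBipartiteOn G S := by
  intro x y
  by_cases hx : x ∈ S <;> by_cases hy : y ∈ S
  · simpa [hx, hy] using fun hxy : G.Adj x y ↦ hS hx hy hxy.ne hxy
  · simpa [hx, hy] using adj_of_degree_eq_card_compl hS hx hy (h x hx)
  · simpa [hx, hy] using (adj_of_degree_eq_card_compl hS hy hx (h y hy)).symm
  · simpa [hx, hy] using fun hxy : G.Adj x y ↦
      hSc (by simpa using hx) (by simpa using hy) hxy.ne hxy

end IndepSetDegrees

section Inequalities

variable {ι R K : Type*} [CommRing R] [LinearOrder R] [IsStrictOrderedRing R]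
  [Field K] [LinearOrder K] [IsStrictOrderedRing K] {s : Finset ι}

/-- The **Diaz–Metcalf inequality** (unweighted). -/
theorem sum_sq_add_card_mul_le {f : ι → R} {a b : R} (ha : ∀ i ∈ s, a ≤ f i)
    (hb : ∀ i ∈ s, f i ≤ b) :
    ∑ i ∈ s, f i ^ 2 + s.card * (a * b) ≤ (a + b) * ∑ i ∈ s, f i := by
  rw [← nsmul_eq_mul, ← Finset.sum_const, ← Finset.sum_add_distrib, Finset.mul_sum]
  refine Finset.sum_le_sum fun i hi ↦ ?_
  linarith [mul_nonneg (sub_nonneg.mpr (ha i hi)) (sub_nonneg.mpr (hb i hi))]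

theorem eq_of_add_le_of_sq_le_four_mul {p q r : R} (h₀ : 0 ≤ p + q) (hle : p + q ≤ r)
    (hsq : r ^ 2 ≤ 4 * q * p) : p = q ∧ r = 2 * q := by
  have hdiff : (p - q) ^ 2 ≤ 0 := by linarith [pow_le_pow_left₀ h₀ hle 2]
  obtain rfl : p = q := sub_eq_zero.mp ((sq_nonpos_iff _).mp hdiff)
  have hrle : r ≤ p + p := le_of_sq_le_sq (hsq.trans_eq (by ring)) h₀
  exact ⟨rfl, (hrle.antisymm hle).trans (two_mul p).symm⟩

variable {f : ι → K} {a b t : K}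

/-- The **Pólya–Szegő inequality**, with `∑ i ∈ s, f i` replaced by an upper bound. -/
theorem sum_sq_le_of_sum_le (hs : s.Nonempty) (ha₀ : 0 < a) (hb₀ : 0 < b)
    (ha : ∀ i ∈ s, a ≤ f i) (hb : ∀ i ∈ s, f i ≤ b) (ht : ∑ i ∈ s, f i ≤ t) :
    ∑ i ∈ s, f i ^ 2 ≤ (t * (a + b)) ^ 2 / (4 * (s.card * (a * b))) := by
  have : (0 : K) < s.card := Nat.cast_pos.mpr hs.card_pos
  rw [le_div_iff₀' (by positivity)]
  calc 4 * (s.card * (a * b)) * ∑ i ∈ s, f i ^ 2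
      ≤ (∑ i ∈ s, f i ^ 2 + s.card * (a * b)) ^ 2 := by
        linarith [sq_nonneg (∑ i ∈ s, f i ^ 2 - s.card * (a * b))]
    _ ≤ (t * (a + b)) ^ 2 := by
        gcongr
        calc _ ≤ (a + b) * ∑ i ∈ s, f i := sum_sq_add_card_mul_le ha hb
          _ ≤ (a + b) * t := by gcongr
          _ = t * (a + b) := mul_comm _ _

theorem sum_eq_and_sum_sq_eq_of_le_sum_sq (hs : s.Nonempty) (ha₀ : 0 < a) (hb₀ : 0 < b)
    (ha : ∀ i ∈ s, a ≤ f i) (hb : ∀ i ∈ s, f i ≤ b) (ht : ∑ i ∈ s, f i ≤ t)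
    (h : (t * (a + b)) ^ 2 / (4 * (s.card * (a * b))) ≤ ∑ i ∈ s, f i ^ 2) :
    ∑ i ∈ s, f i = t ∧ ∑ i ∈ s, f i ^ 2 = s.card * (a * b) := by
  have : (0 : K) < s.card := Nat.cast_pos.mpr hs.card_pos
  have hDM := sum_sq_add_card_mul_le ha hb
  have hsum : (a + b) * ∑ i ∈ s, f i ≤ t * (a + b) := by
    rw [mul_comm t]
    gcongr
  obtain ⟨hsq, heq⟩ := eq_of_add_le_of_sq_le_four_mul (by positivity) (hDM.trans hsum)
    ((div_le_iff₀' (by positivity)).mp h)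
  refine ⟨ht.antisymm (le_of_mul_le_mul_left ?_ (add_pos ha₀ hb₀)), hsq⟩
  linarith

end Inequalities

section ZagrebIndex

open SimpleGraph

variable {V : Type*} [Fintype V] [DecidableEq V] {G : SimpleGraph V} [DecidableRel G.Adj]
  {S : Finset V}

theorem degree_sums_eq_of_le_firstZagrebIndex (hS : G.IsIndepSet (S : Set V))
    (hne : S.Nonempty) (hδ : 0 < G.minDegree)
    (hM : (Sᶜ.card : ℝ) * (G.maxDegree : ℝ) ^ 2 +
        ((G.edgeFinset.card : ℝ) * (G.minDegree + Sᶜ.card)) ^ 2 /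
          (4 * (S.card * (G.minDegree * Sᶜ.card))) ≤ (G.firstZagrebIndex : ℝ)) :
    ∑ x ∈ S, G.degree x = G.edgeFinset.card ∧
      ∑ x ∈ S, G.degree x ^ 2 = S.card * (G.minDegree * Sᶜ.card) ∧
      ∀ y ∈ Sᶜ, G.degree y = G.maxDegree := by
  have hδle : ∀ x ∈ S, G.minDegree ≤ G.degree x := fun x _ ↦ G.minDegree_le_degree x
  have hdle : ∀ x ∈ S, G.degree x ≤ Sᶜ.card := fun x ↦ degree_le_card_compl_of_isIndepSet hS
  have hScpos : 0 < Sᶜ.card := hne.elim fun x hx ↦ hδ.trans_le ((hδle x hx).trans (hdle x hx))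
  have hΔ : ∀ y ∈ Sᶜ, G.degree y ^ 2 ≤ G.maxDegree ^ 2 := fun y _ ↦
    Nat.pow_le_pow_left (G.degree_le_maxDegree y) 2
  rw [← Nat.cast_pos (α := ℝ)] at hδ hScpos
  have hδle' : ∀ x ∈ S, (G.minDegree : ℝ) ≤ G.degree x := by exact_mod_cast hδle
  have hdle' : ∀ x ∈ S, (G.degree x : ℝ) ≤ Sᶜ.card := by exact_mod_cast hdle
  have hedges : ∑ x ∈ S, (G.degree x : ℝ) ≤ G.edgeFinset.card := by
    exact_mod_cast sum_degree_le_card_edgeFinset hS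
  have hcompl : ∑ y ∈ Sᶜ, (G.degree y : ℝ) ^ 2 ≤ Sᶜ.card * (G.maxDegree : ℝ) ^ 2 := by
    exact_mod_cast Finset.sum_le_card_nsmul _ _ _ hΔ
  have hsplit : (∑ x ∈ S, (G.degree x : ℝ) ^ 2) + ∑ y ∈ Sᶜ, (G.degree y : ℝ) ^ 2 =
      G.firstZagrebIndex := by
    rw [Finset.sum_add_sum_compl]
    exact_mod_cast rfl
  obtain ⟨hsum, hsq⟩ := sum_eq_and_sum_sq_eq_of_le_sum_sq hne hδ hScpos hδle' hdle' hedges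
    (by linarith)
  have hcompl' := sum_sq_le_of_sum_le hne hδ hScpos hδle' hdle' hedges
  have hcompl_eq : ∑ y ∈ Sᶜ, (G.degree y : ℝ) ^ 2 = Sᶜ.card * (G.maxDegree : ℝ) ^ 2 := by
    linarith
  refine ⟨by exact_mod_cast hsum, by exact_mod_cast hsq, fun y hy ↦ ?_⟩
  refine Nat.pow_left_injective two_ne_zero ((Finset.sum_eq_sum_iff_of_le hΔ).mp ?_ y hy)
  rw [Finset.sum_const, smul_eq_mul]
  exact_mod_cast hcompl_eq

theorem sum_degree_eq_card_compl_mul_maxDegree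
    (hsum : ∑ x ∈ S, G.degree x = G.edgeFinset.card)
    (hcompl : ∀ y ∈ Sᶜ, G.degree y = G.maxDegree) :
    ∑ x ∈ S, G.degree x = Sᶜ.card * G.maxDegree := by
  have htotal := G.sum_degrees_eq_twice_card_edges
  rw [← Finset.sum_add_sum_compl S, Finset.sum_const_nat hcompl] at htotal
  omega

theorem card_compl_le_card_of_sum_degree_eq (hδ : 0 < G.minDegree)
    (hsum : ∑ x ∈ S, G.degree x = Sᶜ.card * G.maxDegree) : Sᶜ.card ≤ S.card := by
  refine Nat.le_of_mul_le_mul_right ?_ (hδ.trans_le G.minDegree_le_maxDegree)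
  rw [← hsum]
  exact Finset.sum_le_card_nsmul _ _ _ fun x _ ↦ G.degree_le_maxDegree x

theorem degree_eq_card_compl_of_card_compl_eq (hδ : 0 < G.minDegree) (hcard : Sᶜ.card = S.card)
    (hsum : ∑ x ∈ S, G.degree x = Sᶜ.card * G.maxDegree)
    (hsq : ∑ x ∈ S, G.degree x ^ 2 = S.card * (G.minDegree * Sᶜ.card))
    (hcompl : ∀ y ∈ Sᶜ, G.degree y = G.maxDegree) {x : V} (hx : x ∈ S) :
    G.degree x = Sᶜ.card := by
  have hdeg : ∀ x ∈ S, G.degree x = G.maxDegree :=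
    (Finset.sum_eq_sum_iff_of_le fun x _ ↦ G.degree_le_maxDegree x).mp
      (by rw [hsum, hcard, Finset.sum_const, smul_eq_mul])
  have hreg : G.minDegree = G.maxDegree := by
    have : Nonempty V := ⟨x⟩
    obtain ⟨v, hv⟩ := G.exists_minimal_degree_vertex
    by_cases hvS : v ∈ S
    · rw [hv, hdeg v hvS]
    · rw [hv, hcompl v (Finset.mem_compl.mpr hvS)]
  rw [Finset.sum_const_nat fun x hx ↦ by rw [hdeg x hx], hreg, sq] at hsq
  rw [hdeg x hx]
  exact Nat.eq_of_mul_eq_mul_left (hreg ▸ hδ)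
    (Nat.eq_of_mul_eq_mul_left (Finset.card_pos.mpr ⟨x, hx⟩) hsq)

theorem isCompleteBipartiteOn_of_le_firstZagrebIndex (hS : G.IsIndepSet (S : Set V))
    (hne : S.Nonempty) (hδ : 0 < G.minDegree) (hSδ : S.card ≤ G.minDegree + 1)
    (hM : (Sᶜ.card : ℝ) * (G.maxDegree : ℝ) ^ 2 +
        ((G.edgeFinset.card : ℝ) * (G.minDegree + Sᶜ.card)) ^ 2 /
          (4 * (S.card * (G.minDegree * Sᶜ.card))) ≤ (G.firstZagrebIndex : ℝ)) :
    IsCompleteBipartiteOn G S ∧ Sᶜ.card ≤ S.card := by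
  obtain ⟨hsum, hsq, hcompl⟩ := degree_sums_eq_of_le_firstZagrebIndex hS hne hδ hM
  have hsum' := sum_degree_eq_card_compl_mul_maxDegree hsum hcompl
  have hle := card_compl_le_card_of_sum_degree_eq hδ hsum'
  refine ⟨isCompleteBipartiteOn_of_degree_eq_card_compl hS
    (isIndepSet_compl_of_sum_degree_eq hS hsum) fun x hx ↦ ?_, hle⟩
  rcases hle.lt_or_eq with hlt | heq
  · have := G.minDegree_le_degree x
    have := degree_le_card_compl_of_isIndepSet hS hx
    omega
  · exact degree_eq_card_compl_of_card_compl_eq hδ heq hsum' hsq hcompl hx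

end ZagrebIndex

theorem theorem1_general {V : Type*} [Fintype V] [DecidableEq V] (G : SimpleGraph V)
    [DecidableRel G.Adj] (k n e : ℕ) (hk : 1 ≤ k) (hn : 3 ≤ n)
    (hcard : Fintype.card V = n) (hedges : G.edgeFinset.card = e)
    (hconn : G.IsKConnected k)
    (hM : ((n : ℝ) - k - 1) * (G.maxDegree : ℝ) ^ 2
        + ((e : ℝ) * ((G.minDegree : ℝ) + n - k - 1)) ^ 2
          / (4 * (G.minDegree : ℝ) * ((n : ℝ) - k - 1) * ((k : ℝ) + 1))
        ≤ (G.firstZagrebIndex : ℝ)) :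
    G.IsHamiltonian ∨
      Nonempty (G ≃g completeBipartiteGraph (Fin k) (Fin (k + 1))) := by
  refine or_iff_not_imp_left.mpr fun hG ↦ ?_
  subst hcard hedges
  obtain ⟨S, hS, hScard⟩ := exists_isNIndepSet_of_not_isHamiltonian hconn hk hn hG
  have hne : S.Nonempty := Finset.card_pos.mp (by omega)
  have : Nonempty V := hne.to_type
  have hkδ : k ≤ G.minDegree := G.le_minDegree_of_forall_le_degree k
    fun v ↦ le_degree_of_isKConnected hconn v
  have hcompl : (Fintype.card V : ℝ) - k - 1 = Sᶜ.card := by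
    rw [← S.card_add_card_compl, hScard]
    push_cast
    ring
  obtain ⟨hbip, hle⟩ := isCompleteBipartiteOn_of_le_firstZagrebIndex hS hne (by omega) (by omega)
    (hM.trans' <| le_of_eq <| by rw [← hcompl, hScard]; push_cast; ring)
  have hkSc : k ≤ Sᶜ.card := hne.elim fun x hx ↦
    hkδ.trans ((G.minDegree_le_degree x).trans (degree_le_card_compl_of_isIndepSet hS hx))
  rcases hle.lt_or_eq with hlt | heq
  · exact hbip.nonempty_iso (by omega) hScard
  · exact absurd (hbip.isHamiltonian (by omega) hScard (heq.trans hScard)) hG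

theorem theorem1 {V : Type*} [Fintype V] [DecidableEq V] (G : SimpleGraph V)
    [DecidableRel G.Adj] (k n e : ℕ) (hk : 2 ≤ k) (hn : 3 ≤ n)
    (hcard : Fintype.card V = n) (hedges : G.edgeFinset.card = e)
    (hconn : G.IsKConnected k)
    (hM : ((n : ℝ) - k - 1) * (G.maxDegree : ℝ) ^ 2
        + ((e : ℝ) * ((G.minDegree : ℝ) + n - k - 1)) ^ 2
          / (4 * (G.minDegree : ℝ) * ((n : ℝ) - k - 1) * ((k : ℝ) + 1))
        ≤ (G.firstZagrebIndex : ℝ)) :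
    G.IsHamiltonian ∨
      Nonempty (G ≃g completeBipartiteGraph (Fin k) (Fin (k + 1))) :=
  theorem1_general G k n e (one_le_two.trans hk) hn hcard hedges hconn hM
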